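/- **Lemma.** Fix integers $n\ge 0$, $p\ge 0$, $L\ge 1$, $m\ge 1$, a real $\tau\ge 0$, and inputs $x_1,\dots,x_n\in\mathbb R^p$ with $\|x_i\|=1$ (Euclidean norm). Let $\phi(t)=\max\{0,t\}$ act coordinatewise, and let $A\in\mathbb R^{m\times p}$ and $W_1,\dots,W_L\in\mathbb R^{m\times m}$ be random matrices all of whose entries are independent with law $\mathcal N(0,\tfrac2m)$. For each $i$ define the hidden representations of the residual network by $$h_{i,0}=\phi(Ax_i),\qquad h_{i,l}=\phi(h_{i,l-1}+\tau W_l h_{i,l-1})\quad(1\le l\le L-1),\qquad h_{i,L}=\phi(W_L h_{i,L-1}).$$ There is an absolute constant $C>0$ such that for every $c>0$ there are constants $K>0$ and $\kappa>0$, depending only on $c$, such that for all $n,p,L,m,\tau,x_1,\dots,x_n$ as above with $\tau\le \frac{1}{K\sqrt L}$, $$\Pr\Big(\forall\, i\in\{1,\dots,n\},\ \forall\, l\in\{0,1,\dots,L\}:\ \|h_{i,l}\|\in[1-c,1+c]\Big)\ \ge\ 1-C\,nL\,e^{-\kappa m}.$$ -/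

import Mathlib

open MeasureTheory ProbabilityTheory

noncomputable section

namespace ResNet

/-- The ReLU activation `φ(t) = max {0, t}`, applied coordinatewise. -/
def relu {m : ℕ} (v : EuclideanSpace ℝ (Fin m)) : EuclideanSpace ℝ (Fin m) :=
  WithLp.toLp 2 fun k => max 0 (v k)

/-- The product `M v` of a matrix and a Euclidean vector. -/
def mulVec {a b : ℕ} (M : Matrix (Fin a) (Fin b) ℝ) (v : EuclideanSpace ℝ (Fin b)) :
    EuclideanSpace ℝ (Fin a) :=
  WithLp.toLp 2 (M.mulVec v.ofLp)

/-- The hidden representations `h_0, …, h_L` of the residual network on the input `x`: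
`h_0 = φ(A x)`, `h_l = φ(h_{l-1} + τ W_l h_{l-1})` for `1 ≤ l ≤ L - 1`, and
`h_L = φ(W_L h_{L-1})`. The matrix `W_{l+1}` of the text is `W l`, for `l : Fin L`. -/
def hidden {m p L : ℕ} (τ : ℝ) (A : Matrix (Fin m) (Fin p) ℝ)
    (W : Fin L → Matrix (Fin m) (Fin m) ℝ) (x : EuclideanSpace ℝ (Fin p)) :
    Fin (L + 1) → EuclideanSpace ℝ (Fin m) :=
  Fin.induction (motive := fun _ => EuclideanSpace ℝ (Fin m))
    (relu (mulVec A x))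
    (fun l h =>
      if (l : ℕ) + 1 = L then relu (mulVec (W l) h)
      else relu (h + τ • mulVec (W l) h))

/-- The law of the array of entries of an `a × b` random matrix with independent `N(0, v)`
entries. -/
def gaussianMatrix (a b : ℕ) (v : NNReal) : Measure (Fin a → Fin b → ℝ) :=
  Measure.pi fun _ : Fin a => Measure.pi fun _ : Fin b => gaussianReal 0 v

/-- The law of the initialization `(A, (W_1, …, W_L))`: all entries of all these matrices
are independent with law `N(0, 2/m)`. -/
def initLaw (m p L : ℕ) :
    Measure ((Fin m → Fin p → ℝ) × (Fin L → Fin m → Fin m → ℝ)) :=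
  (gaussianMatrix m p (2 / (m : NNReal))).prod
    (Measure.pi fun _ : Fin L => gaussianMatrix m m (2 / (m : NNReal)))

instance (a b : ℕ) (v : NNReal) : IsProbabilityMeasure (gaussianMatrix a b v) := by
  unfold gaussianMatrix
  infer_instance

instance (m p L : ℕ) : IsProbabilityMeasure (initLaw m p L) := by
  unfold initLaw
  infer_instance

end ResNet

end

/-!
For a unit vector `e` and a matrix `W` with independent `N(0, 2/m)` entries, `W e` has independent
`N(0, 2/m)` coordinates. The hidden representation `h` entering a layer depends only on the
weights of the earlier layers, so conditionally on these the direction `e = h / ‖h‖` is fixed, and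
the logarithm of the norm performs a random walk whose increments have explicit exponential moments.

* A pure ReLU layer multiplies `‖h‖²` by `‖φ(W e)‖²`, a sum of `m` independent variables with mean
  `1/m`. By symmetry of the Gaussian law, its moment generating function reduces to that of a squared
  Gaussian (`lintegral_exp_relu_le`), and Chernoff's bound gives deviations `δ` with probability
  at most `exp (-δ² m / 32)`.
* For a residual layer, the ReLU acts on `h + τ W h` with `h ≥ 0` coordinatewise, so it changes the
  squared norm by at most `τ² ‖W h‖²`. Hence `log ‖h‖²` changes by `2 τ ⟪e, W e⟫` up to an error
  `8 τ² ‖W e‖²` (`norm_residual_sq_le`, `le_norm_residual_sq`); `increment` records, for `r = ± τ`,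
  the sum of the two. The exponential moment at scale `m` of one increment is at most
  `exp (40 m τ²)` (`lintegral_exp_step_le`), so that of a partial sum of at most `L` increments is at
  most `exp (40 m τ² L)` (`lintegral_adapted_prod_le`). Since the first-order terms have mean zero
  and are summed before being estimated, `τ² L` and not `τ L` has to be small, and
  `τ ≤ 1 / (K √L)` suffices (`measure_sum_increment_le`).

A union bound over the inputs and the layers concludes.
-/

namespace ResNet
open scoped ENNReal NNReal

/-! ### Gaussian exponential moments -/

theorem lintegral_pi_prod {ι : Type*} [Fintype ι] {α : ι → Type*} [∀ i, MeasurableSpace (α i)]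
    (μ : ∀ i, Measure (α i)) [∀ i, IsProbabilityMeasure (μ i)] {f : ∀ i, α i → ℝ≥0∞}
    (hf : ∀ i, Measurable (f i)) :
    ∫⁻ x, ∏ i, f i (x i) ∂Measure.pi μ = ∏ i, ∫⁻ y, f i y ∂μ i := by
  refine (lintegral_prod_eq_prod_lintegral_of_indepFun Finset.univ
    (fun i (x : ∀ i, α i) => f i (x i)) (iIndepFun_pi fun i => (hf i).aemeasurable)
    fun i => (hf i).comp (measurable_pi_apply i)).trans ?_
  refine Finset.prod_congr rfl fun i _ => ?_
  exact (measurePreserving_eval μ i).lintegral_comp (hf i)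

/-- Rotation invariance, for one row: a unit-norm combination of independent `N(0, v)` variables
has law `N(0, v)`. -/
theorem map_sum_mul_pi_gaussianReal {b : ℕ} (v : ℝ≥0) {e : EuclideanSpace ℝ (Fin b)}
    (he : ‖e‖ = 1) :
    (Measure.pi fun _ : Fin b => gaussianReal 0 v).map (fun w => ∑ j, w j * e j) =
      gaussianReal 0 v := by
  have hm : Measurable fun w : Fin b → ℝ => ∑ j, w j * e j := by fun_prop
  have : IsProbabilityMeasure
      ((Measure.pi fun _ : Fin b => gaussianReal 0 v).map (fun w => ∑ j, w j * e j)) :=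
    Measure.isProbabilityMeasure_map hm.aemeasurable
  refine Measure.ext_of_charFun (funext fun t => ?_)
  rw [charFun_gaussianReal, charFun_apply_real, integral_map hm.aemeasurable (by fun_prop)]
  have h1 : ∀ w : Fin b → ℝ, Complex.exp (t * ((∑ j, w j * e j : ℝ) : ℂ) * Complex.I) =
      ∏ j, Complex.exp (((t * e j : ℝ) : ℂ) * (w j : ℂ) * Complex.I) := by
    intro w
    rw [← Complex.exp_sum]
    push_cast
    rw [Finset.mul_sum, Finset.sum_mul]
    congr 1
    exact Finset.sum_congr rfl fun j _ => by ring
  simp_rw [h1]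
  rw [integral_fintype_prod_eq_prod (𝕜 := ℂ)
    (fun j (y : ℝ) => Complex.exp (((t * e j : ℝ) : ℂ) * (y : ℂ) * Complex.I))]
  simp_rw [← charFun_apply_real, charFun_gaussianReal]
  rw [← Complex.exp_sum]
  have h2 : ∑ j, (e j) ^ 2 = 1 := by
    have := EuclideanSpace.real_norm_sq_eq e
    rw [he] at this; linarith
  congr 1
  have h3 : ∀ j, ((t * e j : ℝ) : ℂ) * ((0 : ℝ) : ℂ) * Complex.I
      - (v : ℂ) * ((t * e j : ℝ) : ℂ) ^ 2 / 2 = (v * t ^ 2 / 2 : ℂ) * (-((e j ^ 2 : ℝ) : ℂ)) := by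
    intro j; push_cast; ring
  rw [Finset.sum_congr rfl fun j _ => h3 j, ← Finset.mul_sum, Finset.sum_neg_distrib,
    ← Complex.ofReal_sum, h2]
  push_cast; ring

/-- Rotation invariance: a Gaussian matrix maps a fixed unit vector to a vector with independent
`N(0, v)` entries. -/
theorem lintegral_gaussianMatrix_prod {a b : ℕ} (v : ℝ≥0) {e : EuclideanSpace ℝ (Fin b)}
    (he : ‖e‖ = 1) {f : Fin a → ℝ → ℝ≥0∞} (hf : ∀ k, Measurable (f k)) :
    ∫⁻ M, ∏ k, f k (mulVec (Matrix.of M) e k) ∂gaussianMatrix a b v =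
      ∏ k, ∫⁻ z, f k z ∂gaussianReal 0 v := by
  have hm : Measurable fun w : Fin b → ℝ => ∑ j, w j * e j := by fun_prop
  have := lintegral_pi_prod (fun _ : Fin a => Measure.pi fun _ : Fin b => gaussianReal 0 v)
    (f := fun k w => f k (∑ j, w j * e j)) fun k => (hf k).comp hm
  refine (this.trans ?_)
  refine Finset.prod_congr rfl fun k _ => ?_
  rw [← lintegral_map (hf k) hm, map_sum_mul_pi_gaussianReal v he]

/-- The exponential moment of a quadratic polynomial of a centred Gaussian variable. -/
theorem lintegral_exp_quadratic_gaussianReal {v : ℝ≥0} (hv : v ≠ 0) (a : ℝ) {b : ℝ}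
    (hb : 2 * b * v < 1) :
    ∫⁻ z, ENNReal.ofReal (Real.exp (a * z + b * z ^ 2)) ∂gaussianReal 0 v =
      ENNReal.ofReal
        ((Real.sqrt (1 - 2 * b * v))⁻¹ * Real.exp (v * a ^ 2 / (2 * (1 - 2 * b * v)))) := by
  have hv0 : (0 : ℝ) < v := by positivity
  have hd : 0 < 1 - 2 * b * v := by linarith
  -- `w` is the variance of the Gaussian density into which the factor `exp (b z ^ 2)` is absorbed
  set w : ℝ≥0 := ⟨v / (1 - 2 * b * v), by positivity⟩ with hw
  have hwv : (w : ℝ) = v / (1 - 2 * b * v) := rfl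
  have hw0 : w ≠ 0 := by
    intro h
    have h' : (w : ℝ) = 0 := by rw [h]; rfl
    rw [hwv] at h'
    have : 0 < (v : ℝ) / (1 - 2 * b * v) := by positivity
    linarith
  have hpdf : ∀ z : ℝ, gaussianPDFReal 0 v z * Real.exp (a * z + b * z ^ 2) =
      (Real.sqrt (1 - 2 * b * v))⁻¹ * (gaussianPDFReal 0 w z * Real.exp (a * z)) := by
    intro z
    have hs : Real.sqrt (2 * Real.pi * v) =
        Real.sqrt (1 - 2 * b * v) * Real.sqrt (2 * Real.pi * w) := by
      rw [← Real.sqrt_mul hd.le, hwv]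
      congr 1
      rw [mul_left_comm, mul_div_cancel₀ _ hd.ne']
    have he : -(z - 0) ^ 2 / (2 * (v : ℝ)) + (a * z + b * z ^ 2) =
        -(z - 0) ^ 2 / (2 * (w : ℝ)) + a * z := by
      rw [hwv]; field_simp; ring
    rw [gaussianPDFReal_def, gaussianPDFReal_def]
    simp only
    rw [mul_assoc, ← Real.exp_add, he, Real.exp_add, hs, mul_inv]
    ring
  have hmgf : ∫⁻ z, ENNReal.ofReal (Real.exp (a * z)) ∂gaussianReal 0 w =
      ENNReal.ofReal (Real.exp (v * a ^ 2 / (2 * (1 - 2 * b * v)))) := by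
    rw [← ofReal_integral_eq_lintegral_ofReal (integrable_exp_mul_gaussianReal a)
      (ae_of_all _ fun z => (Real.exp_pos _).le)]
    have := congrFun (mgf_fun_id_gaussianReal (μ := 0) (v := w)) a
    rw [mgf] at this
    rw [this, hwv]
    congr 2
    field_simp
    ring
  rw [ENNReal.ofReal_mul (by positivity), ← hmgf, gaussianReal_of_var_ne_zero _ hv,
    gaussianReal_of_var_ne_zero _ hw0,
    lintegral_withDensity_eq_lintegral_mul _ (measurable_gaussianPDF _ _) (by fun_prop),
    lintegral_withDensity_eq_lintegral_mul _ (measurable_gaussianPDF _ _) (by fun_prop),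
    ← lintegral_const_mul _ (by
      exact (measurable_gaussianPDF _ _).mul (by fun_prop))]
  refine lintegral_congr fun z => ?_
  simp only [Pi.mul_apply, gaussianPDF]
  rw [← ENNReal.ofReal_mul (gaussianPDFReal_nonneg _ _ _), hpdf, ENNReal.ofReal_mul (by positivity),
    ENNReal.ofReal_mul (gaussianPDFReal_nonneg _ _ _)]

/-- The squared ReLU of a symmetric variable is a fair mixture of `0` and the square. -/
theorem two_mul_lintegral_exp_relu_sq {v : ℝ≥0} (t : ℝ) :
    2 * ∫⁻ z, ENNReal.ofReal (Real.exp (t * max 0 z ^ 2)) ∂gaussianReal 0 v =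
      1 + ∫⁻ z, ENNReal.ofReal (Real.exp (t * z ^ 2)) ∂gaussianReal 0 v := by
  have hneg : ∫⁻ z, ENNReal.ofReal (Real.exp (t * max 0 z ^ 2)) ∂gaussianReal 0 v =
      ∫⁻ z, ENNReal.ofReal (Real.exp (t * max 0 (-z) ^ 2)) ∂gaussianReal 0 v := by
    conv_lhs => rw [← neg_zero, ← gaussianReal_map_neg]
    rw [lintegral_map (by fun_prop) (by fun_prop)]
    simp
  calc _ = ∫⁻ z, ENNReal.ofReal (Real.exp (t * max 0 z ^ 2)) ∂gaussianReal 0 v +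
        ∫⁻ z, ENNReal.ofReal (Real.exp (t * max 0 (-z) ^ 2)) ∂gaussianReal 0 v := by
        rw [← hneg, two_mul]
    _ = ∫⁻ z, (1 + ENNReal.ofReal (Real.exp (t * z ^ 2))) ∂gaussianReal 0 v := by
        rw [← lintegral_add_left (by fun_prop)]
        refine lintegral_congr fun z => ?_
        rcases le_total 0 z with h | h
        · rw [max_eq_right h, max_eq_left (by linarith)]
          simp [add_comm]
        · rw [max_eq_left h, max_eq_right (by linarith)]
          simp
    _ = _ := by
        rw [lintegral_add_left measurable_const]
        simp

theorem inv_sqrt_one_sub_le_exp {x : ℝ} (h0 : 0 ≤ x) (h1 : x ≤ 1 / 2) :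
    (Real.sqrt (1 - x))⁻¹ ≤ Real.exp x := by
  have h2 : 1 + x ≤ Real.exp x := by linarith [Real.add_one_le_exp x]
  refine le_trans ?_ h2
  rw [inv_le_comm₀ (Real.sqrt_pos.2 (by linarith)) (by linarith)]
  apply Real.le_sqrt_of_sq_le
  rw [inv_pow, inv_le_iff_one_le_mul₀ (by positivity)]
  nlinarith [mul_nonneg h0 h0, mul_nonneg h0 (mul_nonneg h0 h0)]

theorem inv_sqrt_one_sub_le {x : ℝ} (h0 : -(1 / 2) ≤ x) (h1 : x ≤ 1 / 2) :
    (Real.sqrt (1 - x))⁻¹ ≤ 1 + x / 2 + x ^ 2 := by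
  have hp : 0 < 1 + x / 2 + x ^ 2 := by nlinarith
  rw [inv_le_comm₀ (Real.sqrt_pos.2 (by linarith)) hp]
  apply Real.le_sqrt_of_sq_le
  rw [inv_pow, inv_le_iff_one_le_mul₀ (by positivity)]
  have : (1 - x) * (1 + x / 2 + x ^ 2) ^ 2 = 1 + x ^ 2 * (5 / 4 * (1 - x) - x ^ 3) := by ring
  rw [this]
  have h3 : x ^ 3 ≤ 5 / 4 * (1 - x) := by
    nlinarith [sq_nonneg x, mul_nonneg (sq_nonneg x) (by linarith : 0 ≤ 1 / 2 - x)]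
  nlinarith [mul_nonneg (sq_nonneg x) (by linarith : 0 ≤ 5 / 4 * (1 - x) - x ^ 3)]

theorem two_div_ne_zero {m : ℕ} (hm : 1 ≤ m) : (2 / (m : ℝ≥0)) ≠ 0 := by
  have : (m : ℝ≥0) ≠ 0 := by exact_mod_cast (by omega : m ≠ 0)
  positivity

/-- One-step exponential moment: for a unit vector `e`, the exponential moment of
`m (2 r ⟪e, W e⟫ + 8 r² ‖W e‖²)` is at most `exp (40 m r²)`. Both terms split over the coordinates
of `W e`, which are independent with law `N(0, 2/m)`. -/
theorem lintegral_exp_step_le {m : ℕ} (hm : 1 ≤ m) {e : EuclideanSpace ℝ (Fin m)} (he : ‖e‖ = 1)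
    {r : ℝ} (hr : r ^ 2 ≤ 1 / 144) :
    ∫⁻ M, ENNReal.ofReal (Real.exp (m * (2 * r * inner ℝ e (mulVec (Matrix.of M) e) +
        8 * r ^ 2 * ‖mulVec (Matrix.of M) e‖ ^ 2)))
      ∂gaussianMatrix m m (2 / (m : ℝ≥0)) ≤ ENNReal.ofReal (Real.exp (40 * m * r ^ 2)) := by
  have hm0 : (0 : ℝ) < m := by exact_mod_cast hm
  have hsplit : ∀ M : Fin m → Fin m → ℝ,
      ENNReal.ofReal (Real.exp (m * (2 * r * inner ℝ e (mulVec (Matrix.of M) e) +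
        8 * r ^ 2 * ‖mulVec (Matrix.of M) e‖ ^ 2))) =
      ∏ k, ENNReal.ofReal (Real.exp ((2 * r * m * e k) * mulVec (Matrix.of M) e k +
        (8 * r ^ 2 * m) * (mulVec (Matrix.of M) e k) ^ 2)) := by
    intro M
    rw [← ENNReal.ofReal_prod_of_nonneg fun k _ => (Real.exp_pos _).le, ← Real.exp_sum]
    congr 2
    rw [EuclideanSpace.real_norm_sq_eq, PiLp.inner_apply, mul_add, Finset.sum_add_distrib,
      Finset.mul_sum, Finset.mul_sum, Finset.mul_sum, Finset.mul_sum]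
    congr 1
    · exact Finset.sum_congr rfl fun k _ => by simp; ring
    · exact Finset.sum_congr rfl fun k _ => by ring
  simp_rw [hsplit]
  rw [lintegral_gaussianMatrix_prod (f := fun k z => ENNReal.ofReal (Real.exp ((2 * r * m * e k) * z
    + (8 * r ^ 2 * m) * z ^ 2))) _ he (fun k => by fun_prop)]
  -- the coordinate `k` contributes `32 r²` from its square and `8 m r² (e k)²` from its linear term
  have hb : 2 * (8 * r ^ 2 * m) * ((2 / (m : ℝ≥0) : ℝ≥0) : ℝ) = 32 * r ^ 2 := by
    push_cast; field_simp; ring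
  have hk : ∀ k, ∫⁻ z, ENNReal.ofReal (Real.exp ((2 * r * m * e k) * z
      + (8 * r ^ 2 * m) * z ^ 2)) ∂gaussianReal 0 (2 / (m : ℝ≥0)) ≤
      ENNReal.ofReal (Real.exp (32 * r ^ 2 + 8 * m * r ^ 2 * (e k) ^ 2)) := by
    intro k
    rw [lintegral_exp_quadratic_gaussianReal (two_div_ne_zero hm) _ (by rw [hb]; linarith), hb,
      Real.exp_add]
    refine ENNReal.ofReal_le_ofReal ?_
    refine mul_le_mul (inv_sqrt_one_sub_le_exp (by positivity) (by linarith)) ?_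
      (Real.exp_pos _).le (Real.exp_pos _).le
    refine Real.exp_le_exp.2 ?_
    rw [div_le_iff₀ (by linarith)]
    push_cast
    have h1 : 2 / (m : ℝ) * (2 * r * m * e k) ^ 2 = 8 * m * r ^ 2 * e k ^ 2 := by
      field_simp; ring
    rw [h1]
    have : 0 ≤ 8 * m * r ^ 2 * e k ^ 2 := by positivity
    exact le_mul_of_one_le_right this (by linarith)
  refine (Finset.prod_le_prod' fun k _ => hk k).trans ?_
  rw [← ENNReal.ofReal_prod_of_nonneg fun k _ => (Real.exp_pos _).le, ← Real.exp_sum,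
    Finset.sum_add_distrib, ← Finset.mul_sum Finset.univ (fun k => e k ^ 2),
    ← EuclideanSpace.real_norm_sq_eq, he]
  refine ENNReal.ofReal_le_ofReal (Real.exp_le_exp.2 (le_of_eq ?_))
  simp only [Finset.sum_const, Finset.card_univ, Fintype.card_fin, nsmul_eq_mul]
  ring

/-- Exponential moment of the squared norm of one ReLU layer applied to a unit vector. -/
theorem lintegral_exp_relu_le {m p : ℕ} (hm : 1 ≤ m) {e : EuclideanSpace ℝ (Fin p)} (he : ‖e‖ = 1)
    {s : ℝ} (hs : |s| ≤ 1 / 8) :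
    ∫⁻ M, ENNReal.ofReal (Real.exp (m * (s * (‖relu (mulVec (Matrix.of M) e)‖ ^ 2 - 1))))
      ∂gaussianMatrix m p (2 / (m : ℝ≥0)) ≤ ENNReal.ofReal (Real.exp (m * (8 * s ^ 2))) := by
  have hm0 : (0 : ℝ) < m := by exact_mod_cast hm
  obtain ⟨hs1, hs2⟩ := abs_le.1 hs
  have hsplit : ∀ M : Fin m → Fin p → ℝ,
      ENNReal.ofReal (Real.exp (m * (s * (‖relu (mulVec (Matrix.of M) e)‖ ^ 2 - 1)))) =
      ∏ k, (ENNReal.ofReal (Real.exp (-s)) *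
        ENNReal.ofReal (Real.exp ((m * s) * max 0 (mulVec (Matrix.of M) e k) ^ 2))) := by
    intro M
    simp_rw [← ENNReal.ofReal_mul (Real.exp_pos _).le, ← Real.exp_add]
    rw [← ENNReal.ofReal_prod_of_nonneg fun k _ => (Real.exp_pos _).le, ← Real.exp_sum]
    congr 2
    rw [EuclideanSpace.real_norm_sq_eq, Finset.sum_add_distrib, ← Finset.mul_sum]
    simp only [relu, Finset.sum_const, Finset.card_univ, Fintype.card_fin, nsmul_eq_mul]
    ring
  simp_rw [hsplit]
  rw [lintegral_gaussianMatrix_prod (f := fun k z => ENNReal.ofReal (Real.exp (-s)) *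
        ENNReal.ofReal (Real.exp ((m * s) * max 0 z ^ 2))) _ he (fun k => by fun_prop)]
  have hb : 2 * (m * s) * ((2 / (m : ℝ≥0) : ℝ≥0) : ℝ) = 4 * s := by
    push_cast; field_simp; ring
  have hrelu : ∫⁻ z, ENNReal.ofReal (Real.exp ((m * s) * max 0 z ^ 2))
      ∂gaussianReal 0 (2 / (m : ℝ≥0)) ≤ ENNReal.ofReal (Real.exp (s + 8 * s ^ 2)) := by
    have h2 := two_mul_lintegral_exp_relu_sq (v := 2 / (m : ℝ≥0)) (m * s)
    have h3 := lintegral_exp_quadratic_gaussianReal (two_div_ne_zero hm) 0 (b := m * s)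
      (by rw [hb]; linarith)
    rw [hb] at h3
    simp only [zero_mul, zero_add, ne_eq, OfNat.ofNat_ne_zero, not_false_eq_true, zero_pow,
      mul_zero, zero_div, Real.exp_zero, mul_one] at h3
    rw [h3] at h2
    refine (ENNReal.mul_le_mul_iff_right (a := 2) (by simp) (by simp)).1 ?_
    rw [h2, ← ENNReal.ofReal_one, ← ENNReal.ofReal_add (by simp) (by positivity),
      ← ENNReal.ofReal_ofNat 2, ← ENNReal.ofReal_mul (by simp)]
    refine ENNReal.ofReal_le_ofReal ?_
    have h4 := inv_sqrt_one_sub_le (x := 4 * s) (by linarith) (by linarith)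
    have h5 := Real.add_one_le_exp (s + 8 * s ^ 2)
    linarith
  refine (Finset.prod_le_prod' (g := fun _ => ENNReal.ofReal (Real.exp (8 * s ^ 2)))
    fun k _ => ?_).trans ?_
  · rw [lintegral_const_mul _ (by fun_prop)]
    refine (mul_le_mul_right hrelu _).trans ?_
    rw [← ENNReal.ofReal_mul (Real.exp_pos _).le, ← Real.exp_add]
    exact ENNReal.ofReal_le_ofReal (Real.exp_le_exp.2 (by linarith))
  · rw [Finset.prod_const, ← ENNReal.ofReal_pow (Real.exp_pos _).le, ← Real.exp_nat_mul]
    simp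

/-! ### Adapted products and Chernoff bounds -/

/-- Resampling one coordinate does not change an expectation over independent coordinates. -/
theorem lintegral_pi_eq_lintegral_update {ι : Type*} [Fintype ι] [DecidableEq ι] {α : ι → Type*}
    [∀ i, MeasurableSpace (α i)] (μ : ∀ i, Measure (α i)) [∀ i, IsProbabilityMeasure (μ i)]
    (i : ι) {f : (∀ i, α i) → ℝ≥0∞} (hf : Measurable f) :
    ∫⁻ x, f x ∂Measure.pi μ = ∫⁻ x, ∫⁻ y, f (Function.update x i y) ∂μ i ∂Measure.pi μ := by
  refine lintegral_eq_of_lmarginal_eq {i} hf ?_ ?_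
  · simp_rw [← lmarginal_singleton]
    exact hf.lmarginal μ
  · simp_rw [← lmarginal_singleton]
    funext x
    rw [lmarginal_singleton (∫⋯∫⁻_{i}, f ∂μ) i]
    simp only
    have : ∀ y, (∫⋯∫⁻_{i}, f ∂μ) (Function.update x i y) = (∫⋯∫⁻_{i}, f ∂μ) x := fun y =>
      lmarginal_update_of_mem μ (Finset.mem_singleton_self i) f x y
    simp [this]

theorem filter_val_lt_add_one {L : ℕ} (l : Fin L) :
    (Finset.univ.filter fun j : Fin L => j.1 < l.1 + 1) =
      insert l (Finset.univ.filter fun j : Fin L => j.1 < l.1) := by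
  ext j
  simp only [Finset.mem_filter, Finset.mem_univ, true_and, Finset.mem_insert, Fin.ext_iff]
  omega

/-- A product of adapted nonnegative factors, each of conditional mean at most `ρ` given the
earlier coordinates, has mean at most `ρ ^ l`. -/
theorem lintegral_adapted_prod_le {α : Type*} [MeasurableSpace α] {L : ℕ} (μ : Measure α)
    [IsProbabilityMeasure μ] (R : Fin L → (Fin L → α) → ℝ≥0∞) (hR : ∀ j, Measurable (R j))
    (hadapt : ∀ j k, j < k → ∀ ω w, R j (Function.update ω k w) = R j ω) (ρ : ℝ≥0∞)
    (hρ : ∀ j ω, ∫⁻ w, R j (Function.update ω j w) ∂μ ≤ ρ) (l : ℕ) (hl : l ≤ L) :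
    ∫⁻ ω, ∏ j with j.1 < l, R j ω ∂Measure.pi (fun _ : Fin L => μ) ≤ ρ ^ l := by
  induction l with
  | zero => simp
  | succ l ih =>
    have hnot : (⟨l, hl⟩ : Fin L) ∉ (Finset.univ.filter fun j : Fin L => j.1 < l) := by simp
    rw [lintegral_pi_eq_lintegral_update (fun _ : Fin L => μ) ⟨l, hl⟩
      (Finset.measurable_fun_prod _ fun j _ => hR j)]
    calc _ = ∫⁻ ω, (∫⁻ w, R ⟨l, hl⟩ (Function.update ω ⟨l, hl⟩ w) ∂μ) * ∏ j with j.1 < l, R j ω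
          ∂Measure.pi (fun _ : Fin L => μ) := by
          refine lintegral_congr fun ω => ?_
          have hmeas : Measurable fun w => R ⟨l, hl⟩ (Function.update ω ⟨l, hl⟩ w) :=
            (hR _).comp (measurable_update ω)
          rw [← lintegral_mul_const _ hmeas]
          refine lintegral_congr fun w => ?_
          rw [filter_val_lt_add_one ⟨l, hl⟩, Finset.prod_insert hnot]
          congr 1
          refine Finset.prod_congr rfl fun j hj => hadapt j _ ?_ ω w
          exact (Finset.mem_filter.1 hj).2
      _ ≤ ∫⁻ ω, ρ * ∏ j with j.1 < l, R j ω ∂Measure.pi (fun _ : Fin L => μ) :=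
          lintegral_mono fun ω => mul_le_mul_left (hρ _ ω) _
      _ = ρ * ∫⁻ ω, ∏ j with j.1 < l, R j ω ∂Measure.pi (fun _ : Fin L => μ) :=
          lintegral_const_mul _ (Finset.measurable_fun_prod _ fun j _ => hR j)
      _ ≤ ρ ^ (l + 1) := by
          rw [pow_succ']
          exact mul_le_mul_right (ih (by omega)) _

/-- Chernoff's bound. -/
theorem measure_lt_le_of_lintegral_exp_le {Ω : Type*} [MeasurableSpace Ω] {μ : Measure Ω}
    {X : Ω → ℝ} (hX : Measurable X) {m B δ η : ℝ} (hm : 0 ≤ m)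
    (hB : ∫⁻ ω, ENNReal.ofReal (Real.exp (m * X ω)) ∂μ ≤ ENNReal.ofReal (Real.exp (m * B)))
    (hη : B + η ≤ δ) :
    μ {ω | δ < X ω} ≤ ENNReal.ofReal (Real.exp (-(η * m))) := by
  have h1 : μ {ω | δ < X ω} ≤
      μ {ω | ENNReal.ofReal (Real.exp (m * δ)) ≤ ENNReal.ofReal (Real.exp (m * X ω))} := by
    refine measure_mono fun ω hω => ENNReal.ofReal_le_ofReal (Real.exp_le_exp.2 ?_)
    exact mul_le_mul_of_nonneg_left (le_of_lt hω) hm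
  refine h1.trans ((meas_ge_le_lintegral_div (by fun_prop) ?_ ENNReal.ofReal_ne_top).trans ?_)
  · exact (ENNReal.ofReal_pos.2 (Real.exp_pos _)).ne'
  · refine (ENNReal.div_le_div_right hB _).trans ?_
    rw [← ENNReal.ofReal_div_of_pos (Real.exp_pos _), ← Real.exp_sub]
    refine ENNReal.ofReal_le_ofReal (Real.exp_le_exp.2 ?_)
    nlinarith [mul_le_mul_of_nonneg_left hη hm]

/-! ### Norms of the hidden representations -/

theorem mulVec_smul {a b : ℕ} (M : Matrix (Fin a) (Fin b) ℝ) (c : ℝ)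
    (v : EuclideanSpace ℝ (Fin b)) : mulVec M (c • v) = c • mulVec M v := by
  ext k
  simp [mulVec, Matrix.mulVec_smul]

theorem relu_smul {m : ℕ} {c : ℝ} (hc : 0 ≤ c) (v : EuclideanSpace ℝ (Fin m)) :
    relu (c • v) = c • relu v := by
  ext k
  simp [relu, mul_max_of_nonneg _ _ hc]

theorem relu_nonneg {m : ℕ} (v : EuclideanSpace ℝ (Fin m)) (k : Fin m) : 0 ≤ relu v k :=
  le_max_left _ _

theorem norm_relu_sq_le {m : ℕ} (v : EuclideanSpace ℝ (Fin m)) : ‖relu v‖ ^ 2 ≤ ‖v‖ ^ 2 := by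
  rw [EuclideanSpace.real_norm_sq_eq, EuclideanSpace.real_norm_sq_eq]
  refine Finset.sum_le_sum fun k _ => ?_
  rcases le_total 0 (v k) with h | h
  · simp [relu, max_eq_right h]
  · simp [relu, max_eq_left h, sq_nonneg]

/-- On the nonnegative orthant the squared norm after a ReLU is bounded below by the
linearization of the squared norm: the mass that the ReLU removes is at most `‖u‖²`. -/
theorem norm_sq_add_le_norm_relu_sq {m : ℕ} {h : EuclideanSpace ℝ (Fin m)} (hh : ∀ k, 0 ≤ h k)
    (u : EuclideanSpace ℝ (Fin m)) : ‖h‖ ^ 2 + 2 * inner ℝ h u ≤ ‖relu (h + u)‖ ^ 2 := by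
  rw [EuclideanSpace.real_norm_sq_eq, EuclideanSpace.real_norm_sq_eq, PiLp.inner_apply,
    Finset.mul_sum, ← Finset.sum_add_distrib]
  refine Finset.sum_le_sum fun k _ => ?_
  have hk := hh k
  simp only [relu, PiLp.add_apply, RCLike.inner_apply, conj_trivial]
  rcases le_total 0 (h k + u k) with h1 | h1
  · rw [max_eq_right h1]
    nlinarith [sq_nonneg (u k)]
  · rw [max_eq_left h1]
    nlinarith

/-- The direction `h / ‖h‖` of a vector; the direction of `0` is, by convention, the basis vector
with index `k₀`, so that it is always a unit vector. -/
noncomputable def unitDir {m : ℕ} (k₀ : Fin m) (h : EuclideanSpace ℝ (Fin m)) :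
    EuclideanSpace ℝ (Fin m) :=
  open Classical in if h = 0 then EuclideanSpace.single k₀ 1 else ‖h‖⁻¹ • h

theorem norm_unitDir {m : ℕ} (k₀ : Fin m) (h : EuclideanSpace ℝ (Fin m)) :
    ‖unitDir k₀ h‖ = 1 := by
  unfold unitDir
  split_ifs with h0
  · simp
  · rw [norm_smul, norm_inv, norm_norm, inv_mul_cancel₀ (norm_ne_zero_iff.2 h0)]

theorem norm_smul_unitDir {m : ℕ} (k₀ : Fin m) (h : EuclideanSpace ℝ (Fin m)) :
    ‖h‖ • unitDir k₀ h = h := by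
  unfold unitDir
  split_ifs with h0
  · simp [h0]
  · rw [smul_smul, mul_inv_cancel₀ (norm_ne_zero_iff.2 h0), one_smul]

theorem measurable_unitDir {m : ℕ} (k₀ : Fin m) : Measurable (unitDir k₀) := by
  unfold unitDir
  refine Measurable.ite (measurableSet_singleton 0) measurable_const ?_
  exact measurable_norm.inv.smul measurable_id

/-- The exponent `2 r ⟪e, W e⟫ + 8 r² ‖W e‖²` controlling, for `r = ± τ`, the change of `log ‖h‖²`
over one residual layer with weights `W`, where `e` is the direction of `h`. -/
noncomputable def increment {m : ℕ} (r : ℝ) (W : Matrix (Fin m) (Fin m) ℝ)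
    (e : EuclideanSpace ℝ (Fin m)) : ℝ :=
  2 * r * inner ℝ e (mulVec W e) + 8 * r ^ 2 * ‖mulVec W e‖ ^ 2

/-- The upper estimate of a residual layer: `‖h + τ W h‖² = ‖h‖² (1 + 2 τ ⟪e, W e⟫ + τ² ‖W e‖²)`
and `1 + x ≤ exp x`. -/
theorem norm_residual_sq_le {m : ℕ} (k₀ : Fin m) (τ : ℝ) (W : Matrix (Fin m) (Fin m) ℝ)
    (h : EuclideanSpace ℝ (Fin m)) :
    ‖relu (h + τ • mulVec W h)‖ ^ 2 ≤ ‖h‖ ^ 2 * Real.exp (increment τ W (unitDir k₀ h)) := by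
  set e := unitDir k₀ h
  have hu : h + τ • mulVec W h = ‖h‖ • (e + τ • mulVec W e) := by
    conv_lhs => rw [← norm_smul_unitDir k₀ h, mulVec_smul]
    rw [smul_add, smul_comm τ]
  refine (norm_relu_sq_le _).trans ?_
  rw [hu, norm_smul, mul_pow, norm_norm]
  refine mul_le_mul_of_nonneg_left ?_ (sq_nonneg _)
  have h1 := Real.add_one_le_exp (increment τ W e)
  rw [norm_add_sq_real, norm_unitDir, inner_smul_right, norm_smul, mul_pow, Real.norm_eq_abs,
    sq_abs]
  unfold increment at h1 ⊢
  nlinarith [mul_nonneg (sq_nonneg τ) (sq_nonneg ‖mulVec W e‖)]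

theorem exp_sub_two_mul_sq_le {x : ℝ} (hx : -(1 / 2) ≤ x) :
    Real.exp (x - 2 * x ^ 2) ≤ 1 + x := by
  have h0 : 0 < 1 + x := by linarith
  rw [← Real.le_log_iff_exp_le h0]
  refine le_trans ?_ (Real.one_sub_inv_le_log_of_pos h0)
  have h1 : 1 - (1 + x)⁻¹ = x / (1 + x) := by field_simp; ring
  rw [h1, le_div_iff₀ h0]
  nlinarith [mul_nonneg (sq_nonneg x) (by linarith : 0 ≤ 1 + 2 * x)]

/-- The lower estimate of a residual layer: the ReLU loses at most the quadratic term, and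
`1 + x ≥ exp (x - 2 x²)` for `x = 2 τ ⟪e, W e⟫`, where `x² ≤ 4 τ² ‖W e‖²` by Cauchy–Schwarz. The
hypothesis on the increment ensures `x ≥ -1/2`. -/
theorem le_norm_residual_sq {m : ℕ} (k₀ : Fin m) {τ : ℝ} {W : Matrix (Fin m) (Fin m) ℝ}
    {h : EuclideanSpace ℝ (Fin m)} (hh : ∀ k, 0 ≤ h k)
    (hinc : increment (-τ) W (unitDir k₀ h) ≤ 1 / 2) :
    ‖h‖ ^ 2 * Real.exp (-increment (-τ) W (unitDir k₀ h)) ≤ ‖relu (h + τ • mulVec W h)‖ ^ 2 := by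
  refine le_trans ?_ (norm_sq_add_le_norm_relu_sq hh _)
  set e := unitDir k₀ h
  have hin : inner ℝ h (τ • mulVec W h) = ‖h‖ ^ 2 * (τ * inner ℝ e (mulVec W e)) := by
    conv_lhs => rw [← norm_smul_unitDir k₀ h, mulVec_smul]
    rw [inner_smul_right, inner_smul_right, inner_smul_left]
    simp only [conj_trivial]
    ring
  have hcs : (inner ℝ e (mulVec W e)) ^ 2 ≤ ‖mulVec W e‖ ^ 2 := by
    have := abs_real_inner_le_norm e (mulVec W e)
    rw [norm_unitDir, one_mul] at this
    exact sq_le_sq.2 (by rwa [abs_of_nonneg (norm_nonneg (mulVec W e))])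
  have hcs' := mul_le_mul_of_nonneg_left hcs (sq_nonneg τ)
  rw [hin]
  have hx : -(1 / 2) ≤ 2 * τ * inner ℝ e (mulVec W e) := by
    unfold increment at hinc
    nlinarith [mul_nonneg (sq_nonneg τ) (sq_nonneg ‖mulVec W e‖)]
  have h1 : Real.exp (-increment (-τ) W e) ≤ 1 + 2 * τ * inner ℝ e (mulVec W e) := by
    refine le_trans (Real.exp_le_exp.2 ?_) (exp_sub_two_mul_sq_le hx)
    unfold increment
    nlinarith
  nlinarith [mul_le_mul_of_nonneg_left h1 (sq_nonneg ‖h‖)]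

section Hidden

variable {m p L : ℕ}

theorem hidden_zero (τ : ℝ) (A : Matrix (Fin m) (Fin p) ℝ) (W : Fin L → Matrix (Fin m) (Fin m) ℝ)
    (x : EuclideanSpace ℝ (Fin p)) : hidden τ A W x 0 = relu (mulVec A x) := rfl

theorem hidden_succ (τ : ℝ) (A : Matrix (Fin m) (Fin p) ℝ) (W : Fin L → Matrix (Fin m) (Fin m) ℝ)
    (x : EuclideanSpace ℝ (Fin p)) (l : Fin L) :
    hidden τ A W x l.succ = if (l : ℕ) + 1 = L then relu (mulVec (W l) (hidden τ A W x l.castSucc))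
      else relu (hidden τ A W x l.castSucc + τ • mulVec (W l) (hidden τ A W x l.castSucc)) := rfl

theorem hidden_nonneg (τ : ℝ) (A : Matrix (Fin m) (Fin p) ℝ)
    (W : Fin L → Matrix (Fin m) (Fin m) ℝ) (x : EuclideanSpace ℝ (Fin p)) (l : Fin (L + 1))
    (k : Fin m) : 0 ≤ hidden τ A W x l k := by
  induction l using Fin.cases with
  | zero => exact relu_nonneg _ _
  | succ l =>
    rw [hidden_succ]
    split_ifs <;> exact relu_nonneg _ _

/-- The first `l` layers do not involve the weights of the later ones. -/
theorem hidden_update (τ : ℝ) (A : Matrix (Fin m) (Fin p) ℝ) (W : Fin L → Matrix (Fin m) (Fin m) ℝ)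
    (x : EuclideanSpace ℝ (Fin p)) (k : Fin L) (w : Matrix (Fin m) (Fin m) ℝ) (l : Fin (L + 1))
    (hl : l ≤ k.castSucc) : hidden τ A (Function.update W k w) x l = hidden τ A W x l := by
  induction l using Fin.induction with
  | zero => rfl
  | succ l ih =>
    have hlk : l < k := Fin.succ_le_castSucc_iff.1 hl
    rw [hidden_succ, hidden_succ, ih (le_of_lt hlk), Function.update_of_ne hlk.ne]

theorem measurable_hidden (τ : ℝ) (x : EuclideanSpace ℝ (Fin p)) (l : Fin (L + 1)) :
    Measurable fun θ : (Fin m → Fin p → ℝ) × (Fin L → Fin m → Fin m → ℝ) =>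
      hidden τ (Matrix.of θ.1) (fun k => Matrix.of (θ.2 k)) x l := by
  refine Continuous.measurable ?_
  induction l using Fin.induction with
  | zero =>
    simp only [hidden_zero, relu, mulVec]
    fun_prop
  | succ l ih =>
    simp only [hidden_succ]
    split_ifs <;>
    · simp only [relu, mulVec]
      fun_prop

theorem norm_hidden_sq_le (k₀ : Fin m) (τ : ℝ) (A : Matrix (Fin m) (Fin p) ℝ)
    (W : Fin L → Matrix (Fin m) (Fin m) ℝ) (x : EuclideanSpace ℝ (Fin p)) (l : Fin (L + 1))
    (hl : l.1 < L) :
    ‖hidden τ A W x l‖ ^ 2 ≤ ‖hidden τ A W x 0‖ ^ 2 *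
      Real.exp (∑ j with j.1 < l.1, increment τ (W j) (unitDir k₀ (hidden τ A W x j.castSucc))) := by
  induction l using Fin.induction with
  | zero => simp
  | succ l ih =>
    rw [Fin.val_succ, filter_val_lt_add_one, Finset.sum_insert (by simp),
      add_comm (increment _ _ _), Real.exp_add, ← mul_assoc, hidden_succ,
      if_neg (by simpa using hl.ne)]
    refine (norm_residual_sq_le k₀ τ (W l) _).trans ?_
    exact mul_le_mul_of_nonneg_right (ih l.2) (Real.exp_pos _).le

theorem le_norm_hidden_sq (k₀ : Fin m) (τ : ℝ) (A : Matrix (Fin m) (Fin p) ℝ)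
    (W : Fin L → Matrix (Fin m) (Fin m) ℝ) (x : EuclideanSpace ℝ (Fin p))
    (hinc : ∀ j, increment (-τ) (W j) (unitDir k₀ (hidden τ A W x j.castSucc)) ≤ 1 / 2)
    (l : Fin (L + 1)) (hl : l.1 < L) :
    ‖hidden τ A W x 0‖ ^ 2 * Real.exp
      (-∑ j with j.1 < l.1, increment (-τ) (W j) (unitDir k₀ (hidden τ A W x j.castSucc))) ≤
      ‖hidden τ A W x l‖ ^ 2 := by
  induction l using Fin.induction with
  | zero => simp
  | succ l ih =>
    rw [Fin.val_succ, filter_val_lt_add_one, Finset.sum_insert (by simp),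
      add_comm (increment _ _ _), neg_add, Real.exp_add, ← mul_assoc,
      hidden_succ, if_neg (by simpa using hl.ne)]
    refine le_trans ?_ (le_norm_residual_sq k₀ (fun k => hidden_nonneg _ _ _ _ _ k) (hinc l))
    exact mul_le_mul_of_nonneg_right (ih l.2) (Real.exp_pos _).le

theorem norm_hidden_last_sq (k₀ : Fin m) (τ : ℝ) (A : Matrix (Fin m) (Fin p) ℝ)
    (W : Fin L → Matrix (Fin m) (Fin m) ℝ) (x : EuclideanSpace ℝ (Fin p)) (j : Fin L)
    (hj : (j : ℕ) + 1 = L) :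
    ‖hidden τ A W x j.succ‖ ^ 2 = ‖hidden τ A W x j.castSucc‖ ^ 2 *
      ‖relu (mulVec (W j) (unitDir k₀ (hidden τ A W x j.castSucc)))‖ ^ 2 := by
  rw [hidden_succ, if_pos hj]
  conv_lhs => rw [← norm_smul_unitDir k₀ (hidden τ A W x j.castSucc), mulVec_smul,
    relu_smul (norm_nonneg _), norm_smul, norm_norm, mul_pow]

/-- Deterministic part: if both square-norm ratios of the ReLU layers are within `δ` of `1` and the
increments and their partial sums are at most `δ ≤ c / 3`, then all norms are within `c` of `1`. -/
theorem norm_hidden_mem_Icc (k₀ : Fin m) (τ : ℝ) (A : Matrix (Fin m) (Fin p) ℝ)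
    (W : Fin L → Matrix (Fin m) (Fin m) ℝ) (x : EuclideanSpace ℝ (Fin p)) {c δ : ℝ}
    (hδ0 : 0 < δ) (hδ1 : δ ≤ 1 / 3) (hδc : 3 * δ ≤ c)
    (h0 : |‖relu (mulVec A x)‖ ^ 2 - 1| ≤ δ)
    (hup : ∀ l : Fin L, ∑ j with j.1 < l.1,
      increment τ (W j) (unitDir k₀ (hidden τ A W x j.castSucc)) ≤ δ)
    (hlow : ∀ l : Fin L, ∑ j with j.1 < l.1,
      increment (-τ) (W j) (unitDir k₀ (hidden τ A W x j.castSucc)) ≤ δ)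
    (hinc : ∀ j, increment (-τ) (W j) (unitDir k₀ (hidden τ A W x j.castSucc)) ≤ δ)
    (hlast : ∀ j : Fin L, (j : ℕ) + 1 = L →
      |‖relu (mulVec (W j) (unitDir k₀ (hidden τ A W x j.castSucc)))‖ ^ 2 - 1| ≤ δ)
    (l : Fin (L + 1)) : ‖hidden τ A W x l‖ ∈ Set.Icc (1 - c) (1 + c) := by
  -- the three factors are: first layer, residual layers, last layer
  have key : ∀ y : ℝ, 0 ≤ y → (1 - δ) ^ 3 ≤ y ^ 2 → y ^ 2 ≤ Real.exp δ ^ 3 →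
      y ∈ Set.Icc (1 - c) (1 + c) := by
    intro y hy hy1 hy2
    have hd1 : 1 - 3 * δ ≤ (1 - δ) ^ 3 := by nlinarith [mul_nonneg hδ0.le hδ0.le]
    refine ⟨?_, ?_⟩
    · by_contra! hlt
      nlinarith
    · have h3 : Real.exp δ ^ 3 = Real.exp (3 * δ / 2) ^ 2 := by
        rw [← Real.exp_nat_mul, ← Real.exp_nat_mul]; congr 1; push_cast; ring
      have h4 : y ≤ Real.exp (3 * δ / 2) := by
        refine le_of_sq_le_sq (by rw [← h3]; exact hy2) (Real.exp_pos _).le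
      have h5 := Real.abs_exp_sub_one_le (x := 3 * δ / 2)
        (by rw [abs_of_nonneg (by positivity)]; linarith)
      rw [abs_of_nonneg (a := 3 * δ / 2) (by positivity)] at h5
      linarith [(abs_le.1 h5).2]
  have he1 : 1 + δ ≤ Real.exp δ := by linarith [Real.add_one_le_exp δ]
  have he2 : 1 - δ ≤ Real.exp (-δ) := by linarith [Real.add_one_le_exp (-δ)]
  have he3 : 1 ≤ Real.exp δ := by linarith
  obtain ⟨h01, h02⟩ := abs_le.1 h0
  have hbulk : ∀ l : Fin (L + 1), l.1 < L → (1 - δ) ^ 2 ≤ ‖hidden τ A W x l‖ ^ 2 ∧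
      ‖hidden τ A W x l‖ ^ 2 ≤ Real.exp δ ^ 2 := by
    intro l hl
    have hu := norm_hidden_sq_le k₀ τ A W x l hl
    have hd := le_norm_hidden_sq k₀ τ A W x (fun j => (hinc j).trans (by linarith)) l hl
    rw [hidden_zero] at hu hd
    refine ⟨le_trans ?_ hd, hu.trans ?_⟩
    · rw [pow_two (1 - δ)]
      refine mul_le_mul (by linarith) (he2.trans (Real.exp_le_exp.2 ?_)) (by linarith) (sq_nonneg _)
      linarith [hlow ⟨l.1, hl⟩]
    · rw [pow_two (Real.exp δ)]
      exact mul_le_mul (by linarith) (Real.exp_le_exp.2 (hup ⟨l.1, hl⟩)) (Real.exp_pos _).le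
        (by linarith)
  by_cases hl : l.1 < L
  · obtain ⟨h1, h2⟩ := hbulk l hl
    refine key _ (norm_nonneg _) (le_trans ?_ h1) (h2.trans (pow_le_pow_right₀ he3 (by norm_num)))
    exact pow_le_pow_of_le_one (by linarith) (by linarith) (by norm_num)
  · rcases Fin.eq_zero_or_eq_succ l with rfl | ⟨j, rfl⟩
    · rw [hidden_zero]
      refine key _ (norm_nonneg _) ?_ ?_
      · have := pow_le_of_le_one (a := 1 - δ) (by linarith) (by linarith) (three_ne_zero)
        linarith
      · have := le_self_pow₀ he3 (three_ne_zero)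
        linarith
    · have hj : (j : ℕ) + 1 = L := by
        have := j.2
        simp only [Fin.val_succ] at hl
        omega
      obtain ⟨h1, h2⟩ := hbulk j.castSucc j.2
      obtain ⟨h3, h4⟩ := abs_le.1 (hlast j hj)
      refine key _ (norm_nonneg _) ?_ ?_ <;> rw [norm_hidden_last_sq k₀ τ A W x j hj]
      · rw [pow_succ (1 - δ) 2]
        exact mul_le_mul h1 (by linarith) (by linarith) (sq_nonneg _)
      · rw [pow_succ (Real.exp δ) 2]
        exact mul_le_mul h2 (by linarith) (sq_nonneg _) (by positivity)

end Hidden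

/-! ### Tail bounds for the network -/

section Tails

variable {m p L : ℕ}

/-- The parameters `(A, (W_1, …, W_L))` of the network, as arrays of entries. -/
abbrev Params (m p L : ℕ) : Type := (Fin m → Fin p → ℝ) × (Fin L → Fin m → Fin m → ℝ)

/-- The direction of the hidden representation that enters the layer with weights `W j`. -/
noncomputable def inputDir (k₀ : Fin m) (τ : ℝ) (x : EuclideanSpace ℝ (Fin p)) (j : Fin L)
    (θ : Params m p L) : EuclideanSpace ℝ (Fin m) :=
  unitDir k₀ (hidden τ (Matrix.of θ.1) (fun k => Matrix.of (θ.2 k)) x j.castSucc)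

theorem norm_inputDir (k₀ : Fin m) (τ : ℝ) (x : EuclideanSpace ℝ (Fin p)) (j : Fin L)
    (θ : Params m p L) : ‖inputDir k₀ τ x j θ‖ = 1 :=
  norm_unitDir _ _

/-- The direction entering a layer is unaffected by the weights of that layer and of later ones. -/
theorem inputDir_update (k₀ : Fin m) (τ : ℝ) (x : EuclideanSpace ℝ (Fin p)) {j k : Fin L}
    (hjk : j ≤ k) (a : Fin m → Fin p → ℝ) (ω : Fin L → Fin m → Fin m → ℝ)
    (w : Fin m → Fin m → ℝ) :
    inputDir k₀ τ x j (a, Function.update ω k w) = inputDir k₀ τ x j (a, ω) :=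
  congrArg (unitDir k₀) (hidden_update τ (Matrix.of a) (fun i => Matrix.of (ω i)) x k (Matrix.of w)
    j.castSucc (by simpa using hjk))

theorem measurable_inputDir (k₀ : Fin m) (τ : ℝ) (x : EuclideanSpace ℝ (Fin p)) (j : Fin L) :
    Measurable (inputDir k₀ τ x j) :=
  (measurable_unitDir k₀).comp (measurable_hidden τ x _)

theorem measurable_mulVec_inputDir (k₀ : Fin m) (τ : ℝ) (x : EuclideanSpace ℝ (Fin p))
    (j : Fin L) :
    Measurable fun θ : Params m p L => mulVec (Matrix.of (θ.2 j)) (inputDir k₀ τ x j θ) := by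
  have h1 : Measurable fun q : (Fin m → Fin m → ℝ) × EuclideanSpace ℝ (Fin m) =>
      mulVec (Matrix.of q.1) q.2 := by
    refine Continuous.measurable ?_
    simp only [mulVec]
    fun_prop
  exact h1.comp (Measurable.prodMk (by fun_prop) (measurable_inputDir k₀ τ x j))

theorem measurable_increment (k₀ : Fin m) (r τ : ℝ) (x : EuclideanSpace ℝ (Fin p)) (j : Fin L) :
    Measurable fun θ : Params m p L => increment r (Matrix.of (θ.2 j)) (inputDir k₀ τ x j θ) := by
  have h1 := measurable_mulVec_inputDir k₀ τ x j
  have h2 := measurable_inputDir k₀ τ x j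
  exact (measurable_const.mul (h2.inner h1)).add (measurable_const.mul (h1.norm.pow_const 2))

/-- An expectation is bounded by a uniform bound on its conditional expectations given all weights
except `W j`. -/
theorem lintegral_initLaw_le_of_update {F : Params m p L → ℝ≥0∞} (hF : Measurable F) (j : Fin L)
    {B : ℝ≥0∞}
    (hB : ∀ a ω, ∫⁻ w, F (a, Function.update ω j w) ∂gaussianMatrix m m (2 / (m : ℝ≥0)) ≤ B) :
    ∫⁻ θ, F θ ∂initLaw m p L ≤ B := by
  unfold initLaw
  rw [lintegral_prod _ hF.aemeasurable]
  refine (lintegral_mono (g := fun _ => B) fun a => ?_).trans (by simp)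
  simp only
  rw [lintegral_pi_eq_lintegral_update (fun _ : Fin L => gaussianMatrix m m (2 / (m : ℝ≥0))) j
    (f := fun ω => F (a, ω)) (hF.comp measurable_prodMk_left)]
  exact (lintegral_mono (hB a)).trans (by simp)

theorem lintegral_initLaw_adapted_prod_le {F : Fin L → Params m p L → ℝ≥0∞}
    (hF : ∀ j, Measurable (F j))
    (hadapt : ∀ j k, j < k → ∀ a ω w, F j (a, Function.update ω k w) = F j (a, ω)) {ρ : ℝ≥0∞}
    (hρ : ∀ j a ω, ∫⁻ w, F j (a, Function.update ω j w) ∂gaussianMatrix m m (2 / (m : ℝ≥0)) ≤ ρ)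
    (l : Fin L) :
    ∫⁻ θ, ∏ j with j.1 < l.1, F j θ ∂initLaw m p L ≤ ρ ^ l.1 := by
  unfold initLaw
  rw [lintegral_prod _ (Finset.measurable_fun_prod _ fun j _ => hF j).aemeasurable]
  refine (lintegral_mono (g := fun _ => ρ ^ l.1) fun a => ?_).trans (by simp)
  exact lintegral_adapted_prod_le _ (fun j ω => F j (a, ω))
    (fun j => (hF j).comp measurable_prodMk_left) (fun j k hjk => hadapt j k hjk a) ρ
    (fun j => hρ j a) l.1 l.2.le

/-- Tail bound for the first layer; the sign `σ` selects the upper or the lower tail. -/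
theorem measure_first_layer_le (hm : 1 ≤ m) {x : EuclideanSpace ℝ (Fin p)} (hx : ‖x‖ = 1) {δ σ : ℝ}
    (hδ0 : 0 < δ) (hδ1 : δ ≤ 1) (hσ : |σ| = 1) :
    initLaw m p L {θ | δ < σ * (‖relu (mulVec (Matrix.of θ.1) x)‖ ^ 2 - 1)} ≤
      ENNReal.ofReal (Real.exp (-(δ ^ 2 / 32 * m))) := by
  have hmeas : Measurable fun a : Fin m → Fin p → ℝ =>
      (δ / 16 * σ) * (‖relu (mulVec (Matrix.of a) x)‖ ^ 2 - 1) := by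
    refine Continuous.measurable ?_
    simp only [relu, mulVec]
    fun_prop
  have hmeas' : Measurable fun θ : Params m p L =>
      (δ / 16 * σ) * (‖relu (mulVec (Matrix.of θ.1) x)‖ ^ 2 - 1) := hmeas.comp measurable_fst
  have hs : |δ / 16 * σ| ≤ 1 / 8 := by
    rw [abs_mul, hσ, abs_of_pos (by positivity)]
    linarith
  -- `s = δ / 16` minimizes the Chernoff exponent `8 s ^ 2 - s δ`, with value `-δ ^ 2 / 32`
  have h := measure_lt_le_of_lintegral_exp_le (μ := initLaw m p L)
    hmeas' (m := m) (B := 8 * (δ / 16 * σ) ^ 2) (δ := δ ^ 2 / 16)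
    (η := δ ^ 2 / 32) (Nat.cast_nonneg m) ?_ ?_
  · refine le_trans (measure_mono fun θ hθ => ?_) h
    simp only [Set.mem_ofPred_eq] at hθ ⊢
    nlinarith
  · unfold initLaw
    rw [lintegral_prod _ (hmeas'.const_mul _).exp.ennreal_ofReal.aemeasurable]
    simpa using lintegral_exp_relu_le hm hx hs
  · rw [mul_pow, ← sq_abs σ, hσ]
    linarith

/-- Tail bound for a ReLU layer applied to the direction of the representation that enters it. -/
theorem measure_last_layer_le (hm : 1 ≤ m) (k₀ : Fin m) (τ : ℝ) (x : EuclideanSpace ℝ (Fin p))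
    (j : Fin L) {δ σ : ℝ} (hδ0 : 0 < δ) (hδ1 : δ ≤ 1) (hσ : |σ| = 1) :
    initLaw m p L {θ | δ < σ *
      (‖relu (mulVec (Matrix.of (θ.2 j)) (inputDir k₀ τ x j θ))‖ ^ 2 - 1)} ≤
      ENNReal.ofReal (Real.exp (-(δ ^ 2 / 32 * m))) := by
  have hrelu : Measurable fun v : EuclideanSpace ℝ (Fin m) =>
      (δ / 16 * σ) * (‖relu v‖ ^ 2 - 1) := by
    refine Continuous.measurable ?_
    simp only [relu]
    fun_prop
  have hmeas : Measurable fun θ : Params m p L => (δ / 16 * σ) *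
      (‖relu (mulVec (Matrix.of (θ.2 j)) (inputDir k₀ τ x j θ))‖ ^ 2 - 1) :=
    hrelu.comp (measurable_mulVec_inputDir k₀ τ x j)
  have hs : |δ / 16 * σ| ≤ 1 / 8 := by
    rw [abs_mul, hσ, abs_of_pos (by positivity)]
    linarith
  have h := measure_lt_le_of_lintegral_exp_le (μ := initLaw m p L)
    hmeas (m := m) (B := 8 * (δ / 16 * σ) ^ 2) (δ := δ ^ 2 / 16)
    (η := δ ^ 2 / 32) (Nat.cast_nonneg m) ?_ ?_
  · refine le_trans (measure_mono fun θ hθ => ?_) h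
    simp only [Set.mem_ofPred_eq] at hθ ⊢
    nlinarith
  · refine lintegral_initLaw_le_of_update (hmeas.const_mul _).exp.ennreal_ofReal j fun a ω => ?_
    simp only [inputDir_update k₀ τ x le_rfl, Function.update_self]
    exact lintegral_exp_relu_le hm (norm_inputDir _ _ _ _ _) hs
  · rw [mul_pow, ← sq_abs σ, hσ]
    linarith

/-- Tail bound for the partial sums of the increments: given the earlier layers the direction is a
fixed unit vector, so each increment contributes a factor at most `exp (40 m r²)` to the
exponential moment. -/
theorem measure_sum_increment_le (hm : 1 ≤ m) (k₀ : Fin m) {r τ δ : ℝ}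
    (hδ0 : 0 < δ) (hδ1 : δ ≤ 1) (hr : r ^ 2 * L ≤ δ ^ 2 / 144) (x : EuclideanSpace ℝ (Fin p))
    (l : Fin L) :
    initLaw m p L
      {θ | δ < ∑ j with j.1 < l.1, increment r (Matrix.of (θ.2 j)) (inputDir k₀ τ x j θ)} ≤
      ENNReal.ofReal (Real.exp (-(δ ^ 2 / 32 * m))) := by
  have hL : (1 : ℝ) ≤ L := by exact_mod_cast l.pos
  have hlL : (l.1 : ℝ) ≤ L := by exact_mod_cast l.2.le
  have hr1 : r ^ 2 ≤ δ ^ 2 / 144 := (le_mul_of_one_le_right (sq_nonneg r) hL).trans hr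
  have hr2 : r ^ 2 * l ≤ δ ^ 2 / 144 :=
    (mul_le_mul_of_nonneg_left hlL (sq_nonneg r)).trans hr
  refine measure_lt_le_of_lintegral_exp_le (Finset.measurable_fun_sum _
    fun j _ => measurable_increment k₀ r τ x j) (m := m) (B := 40 * r ^ 2 * l)
    (Nat.cast_nonneg m) ?_ (by nlinarith)
  simp_rw [Finset.mul_sum, Real.exp_sum]
  simp_rw [ENNReal.ofReal_prod_of_nonneg fun k _ => (Real.exp_pos _).le]
  refine (lintegral_initLaw_adapted_prod_le (F := fun j θ => ENNReal.ofReal (Real.exp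
    (m * increment r (Matrix.of (θ.2 j)) (inputDir k₀ τ x j θ))))
    (ρ := ENNReal.ofReal (Real.exp (40 * m * r ^ 2)))
    (fun j => ((measurable_increment k₀ r τ x j).const_mul _).exp.ennreal_ofReal) ?_ ?_ l).trans ?_
  · intro j k hjk a ω w
    simp only [inputDir_update k₀ τ x hjk.le, Function.update_of_ne hjk.ne]
  · intro j a ω
    simp only [inputDir_update k₀ τ x le_rfl, Function.update_self]
    exact lintegral_exp_step_le hm (norm_inputDir _ _ _ _ _) (by nlinarith)
  · rw [← ENNReal.ofReal_pow (Real.exp_pos _).le, ← Real.exp_nat_mul]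
    exact le_of_eq (by congr 2; ring)

/-- Tail bound for a single increment; it makes the increments small enough for the lower bound of
`le_norm_residual_sq`. -/
theorem measure_increment_le (hm : 1 ≤ m) (k₀ : Fin m) {r τ δ : ℝ}
    (hδ0 : 0 < δ) (hδ1 : δ ≤ 1) (hr : r ^ 2 * L ≤ δ ^ 2 / 144) (x : EuclideanSpace ℝ (Fin p))
    (j : Fin L) :
    initLaw m p L {θ | δ < increment r (Matrix.of (θ.2 j)) (inputDir k₀ τ x j θ)} ≤
      ENNReal.ofReal (Real.exp (-(δ ^ 2 / 32 * m))) := by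
  have hL : (1 : ℝ) ≤ L := by exact_mod_cast j.pos
  have hr1 : r ^ 2 ≤ δ ^ 2 / 144 := (le_mul_of_one_le_right (sq_nonneg r) hL).trans hr
  have hmeas := measurable_increment k₀ r τ x j
  refine measure_lt_le_of_lintegral_exp_le hmeas (m := m) (B := 40 * r ^ 2)
    (Nat.cast_nonneg m) ?_ (by nlinarith)
  refine lintegral_initLaw_le_of_update (hmeas.const_mul _).exp.ennreal_ofReal j fun a ω => ?_
  simp only [inputDir_update k₀ τ x le_rfl, Function.update_self]
  refine (lintegral_exp_step_le hm (norm_inputDir _ _ _ _ _) (by nlinarith)).trans ?_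
  exact le_of_eq (by congr 2; ring)

/-- Failure probability for a single input: two tails for each of the two pure ReLU layers and three
tails for each `l : Fin L`, in total `4 + 3 L ≤ 7 L` events. -/
theorem measure_not_norm_hidden_mem_Icc_le (hm : 1 ≤ m) (hL : 1 ≤ L) {τ c δ : ℝ}
    (hδ0 : 0 < δ) (hδ1 : δ ≤ 1 / 3) (hδc : 3 * δ ≤ c) (hτ : τ ^ 2 * L ≤ δ ^ 2 / 144)
    {x : EuclideanSpace ℝ (Fin p)} (hx : ‖x‖ = 1) :
    initLaw m p L {θ | ¬ ∀ l : Fin (L + 1),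
      ‖hidden τ (Matrix.of θ.1) (fun k => Matrix.of (θ.2 k)) x l‖ ∈ Set.Icc (1 - c) (1 + c)} ≤
      7 * L * ENNReal.ofReal (Real.exp (-(δ ^ 2 / 32 * m))) := by
  set t := ENNReal.ofReal (Real.exp (-(δ ^ 2 / 32 * m)))
  let k₀ : Fin m := ⟨0, hm⟩
  let jL : Fin L := ⟨L - 1, by omega⟩
  have hδ1' : δ ≤ 1 := by linarith
  have hτ' : (-τ) ^ 2 * L ≤ δ ^ 2 / 144 := by rwa [neg_sq]
  set μ := initLaw m p L
  -- `F`, `E`: tails of the first and the last layer; `S`: tails of the partial sums of increments;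
  -- `D`: tails of single increments, needed for the lower bound only
  let F : ℝ → Set (Params m p L) := fun σ =>
    {θ | δ < σ * (‖relu (mulVec (Matrix.of θ.1) x)‖ ^ 2 - 1)}
  let E : ℝ → Set (Params m p L) := fun σ =>
    {θ | δ < σ * (‖relu (mulVec (Matrix.of (θ.2 jL)) (inputDir k₀ τ x jL θ))‖ ^ 2 - 1)}
  let S : ℝ → Fin L → Set (Params m p L) := fun r l =>
    {θ | δ < ∑ j with j.1 < l.1, increment r (Matrix.of (θ.2 j)) (inputDir k₀ τ x j θ)}
  let D : Fin L → Set (Params m p L) := fun j =>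
    {θ | δ < increment (-τ) (Matrix.of (θ.2 j)) (inputDir k₀ τ x j θ)}
  have hF : ∀ σ : ℝ, |σ| = 1 → μ (F σ) ≤ t := fun σ hσ =>
    measure_first_layer_le hm hx hδ0 hδ1' hσ
  have hE : ∀ σ : ℝ, |σ| = 1 → μ (E σ) ≤ t := fun σ hσ =>
    measure_last_layer_le hm k₀ τ x jL hδ0 hδ1' hσ
  have hS : ∀ l, μ (S τ l ∪ S (-τ) l ∪ D l) ≤ t + t + t := fun l =>
    (measure_union_le _ _).trans (add_le_add ((measure_union_le _ _).trans (add_le_add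
      (measure_sum_increment_le hm k₀ hδ0 hδ1' hτ x l)
      (measure_sum_increment_le hm k₀ hδ0 hδ1' hτ' x l)))
      (measure_increment_le hm k₀ hδ0 hδ1' hτ' x l))
  have hsub : {θ : Params m p L | ¬ ∀ l : Fin (L + 1),
      ‖hidden τ (Matrix.of θ.1) (fun k => Matrix.of (θ.2 k)) x l‖ ∈ Set.Icc (1 - c) (1 + c)} ⊆
      (F 1 ∪ F (-1)) ∪ (E 1 ∪ E (-1)) ∪ ⋃ l, (S τ l ∪ S (-τ) l ∪ D l) := by
    intro θ hθ
    by_contra hn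
    refine hθ (norm_hidden_mem_Icc k₀ τ (Matrix.of θ.1) (fun k => Matrix.of (θ.2 k)) x hδ0 hδ1 hδc
      ?_ ?_ ?_ ?_ ?_)
    all_goals
      simp only [F, E, S, D, inputDir, Set.mem_union, Set.mem_iUnion, Set.mem_ofPred_eq,
        not_or, not_exists, not_lt] at hn
      obtain ⟨⟨⟨hF1, hF2⟩, hE1, hE2⟩, hl⟩ := hn
    · exact abs_le.2 ⟨by linarith, by linarith⟩
    · exact fun l => (hl l).1.1
    · exact fun l => (hl l).1.2
    · exact fun l => (hl l).2
    · intro j hj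
      obtain rfl : j = jL := Fin.ext (by simp only [jL]; omega)
      exact abs_le.2 ⟨by linarith, by linarith⟩
  have h1 : μ ((F 1 ∪ F (-1)) ∪ (E 1 ∪ E (-1)) ∪ ⋃ l, (S τ l ∪ S (-τ) l ∪ D l)) ≤
      ((t + t) + (t + t)) + ∑ _l : Fin L, (t + t + t) := by
    refine (measure_union_le _ _).trans (add_le_add ((measure_union_le _ _).trans (add_le_add
      ((measure_union_le _ _).trans (add_le_add (hF 1 (by norm_num)) (hF (-1) (by norm_num))))
      ((measure_union_le _ _).trans (add_le_add (hE 1 (by norm_num)) (hE (-1) (by norm_num)))))) ?_)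
    exact (measure_iUnion_fintype_le _ _).trans (Finset.sum_le_sum fun l _ => hS l)
  refine (measure_mono hsub).trans (h1.trans ?_)
  have hL' : (1 : ℝ≥0∞) ≤ L := by exact_mod_cast hL
  calc _ = 4 * 1 * t + 3 * L * t := by
        simp only [Finset.sum_const, Finset.card_univ, Fintype.card_fin, nsmul_eq_mul]; ring
    _ ≤ 4 * L * t + 3 * L * t := by gcongr
    _ = _ := by ring

end Tails

end ResNet

theorem mainTheorem6 :
    ∃ C : ℝ, 0 < C ∧ ∀ c : ℝ, 0 < c →
      ∃ K : ℝ, 0 < K ∧ ∃ κ : ℝ, 0 < κ ∧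
        ∀ (n L m p : ℕ), 1 ≤ L → 1 ≤ m →
        ∀ τ : ℝ, 0 ≤ τ → τ ≤ 1 / (K * Real.sqrt L) →
        ∀ x : Fin n → EuclideanSpace ℝ (Fin p), (∀ i, ‖x i‖ = 1) →
          1 - C * (n * L) * Real.exp (-(κ * m)) ≤
            (ResNet.initLaw m p L).real
              {θ | ∀ (i : Fin n) (l : Fin (L + 1)),
                ‖ResNet.hidden τ (Matrix.of θ.1) (fun k => Matrix.of (θ.2 k)) (x i) l‖ ∈
                  Set.Icc (1 - c) (1 + c)} := by
  refine ⟨7, by norm_num, fun c hc => ?_⟩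
  obtain ⟨δ, hδ0, hδ1, hδc⟩ : ∃ δ : ℝ, 0 < δ ∧ δ ≤ 1 / 3 ∧ 3 * δ ≤ c := by
    refine ⟨min 1 c / 3, by positivity, ?_, ?_⟩
    · linarith [min_le_left 1 c]
    · linarith [min_le_right 1 c]
  -- with `K = 12 / δ` the hypothesis on `τ` reads `τ ^ 2 * L ≤ δ ^ 2 / 144`
  refine ⟨12 / δ, by positivity, δ ^ 2 / 32, by positivity, ?_⟩
  intro n L m p hL hm τ hτ0 hτ x hx
  have hL0 : (0 : ℝ) < L := by exact_mod_cast hL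
  have hτL : τ ^ 2 * L ≤ δ ^ 2 / 144 := by
    have h1 : τ ^ 2 ≤ (1 / (12 / δ * Real.sqrt L)) ^ 2 := pow_le_pow_left₀ hτ0 hτ 2
    have h2 : (1 / (12 / δ * Real.sqrt L)) ^ 2 = δ ^ 2 / 144 / L := by
      rw [div_pow, mul_pow, Real.sq_sqrt hL0.le]
      field_simp
      norm_num
    rw [h2, le_div_iff₀ hL0] at h1
    exact h1
  set G := {θ : ResNet.Params m p L |
    ∀ (i : Fin n) (l : Fin (L + 1)),
      ‖ResNet.hidden τ (Matrix.of θ.1) (fun k => Matrix.of (θ.2 k)) (x i) l‖ ∈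
        Set.Icc (1 - c) (1 + c)} with hG
  have hsub : Gᶜ ⊆ ⋃ i : Fin n, {θ | ¬ ∀ l : Fin (L + 1),
      ‖ResNet.hidden τ (Matrix.of θ.1) (fun k => Matrix.of (θ.2 k)) (x i) l‖ ∈
        Set.Icc (1 - c) (1 + c)} := by
    intro θ hθ
    rw [hG, Set.mem_compl_iff, Set.mem_ofPred_eq, not_forall] at hθ
    exact Set.mem_iUnion.2 hθ
  have hbad : (ResNet.initLaw m p L).real Gᶜ ≤
      7 * (n * L) * Real.exp (-(δ ^ 2 / 32 * m)) := by
    refine ENNReal.toReal_le_of_le_ofReal (by positivity) ?_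
    refine (measure_mono hsub).trans ((measure_iUnion_fintype_le _ _).trans ((Finset.sum_le_sum
      fun i _ => ResNet.measure_not_norm_hidden_mem_Icc_le hm hL hδ0 hδ1 hδc hτL (hx i)).trans
        (le_of_eq ?_)))
    rw [ENNReal.ofReal_mul (by positivity), ENNReal.ofReal_mul (by positivity),
      ENNReal.ofReal_mul (by positivity), ENNReal.ofReal_natCast, ENNReal.ofReal_natCast,
      ENNReal.ofReal_ofNat]
    simp only [Finset.sum_const, Finset.card_univ, Fintype.card_fin, nsmul_eq_mul]
    ring
  have htot : 1 ≤ (ResNet.initLaw m p L).real G + (ResNet.initLaw m p L).real Gᶜ := by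
    rw [← probReal_univ (μ := ResNet.initLaw m p L), ← Set.union_compl_self G]
    exact measureReal_union_le _ _
  linarith
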